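/- Let $a,N$ be integers with $1\le a\le N$. For $\boldsymbol{s}=(s_1,\ldots,s_u)\in\mathbb{N}^u$ with $s_1>1$ (where $\mathbb N=\{1,2,\ldots\}$ and $\mathbb N_0=\mathbb N\cup\{0\}$) let $$t^{\star}_{N,a}(s_1,\ldots,s_u)=\sum_{k_1\ge\cdots\ge k_u\ge 0}\frac{1}{(Nk_1+a)^{s_1}\cdots(Nk_u+a)^{s_u}}.$$ For $\boldsymbol{s}\in(\mathbb Z\setminus\{0\})^u$ let $$\widetilde t_{N,a}(s_1,\ldots,s_u)=\sum_{k_1>\cdots>k_u\ge0}\frac{\operatorname{sign}(s_1)^{k_1}\cdots\operatorname{sign}(s_u)^{k_u}}{(Nk_1+a)^{|s_1|}\cdots(Nk_u+a)^{|s_u|}}\cdot\frac{\left(\frac{2a}{N}\right)_{k_u}}{k_u!}$$ whenever this multiple series converges absolutely, where $(x)_n=x(x+1)\cdots(x+n-1)$ and $(x)_0=1$. For a real number $r$ let $$\widetilde t^{\,r}_{N,a}(s_1,\ldots,s_u)=\sum r^{\#\text{pluses}}\,\widetilde t_{N,a}(s_1\circ s_2\circ\cdots\circ s_u),$$ where the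 sum runs over all $2^{u-1}$ ways of replacing each $\circ$ by a comma or by a plus, and the plus denotes the signed addition $s+l=|s|+|l|$ if $sl>0$ and $s+l=-(|s|+|l|)$ if $sl<0$. A bar over a positive entry $s$ stands for $-s$, $\{2\}^b$ denotes $2$ repeated $b$ times, and $B$ is the Beta function. Then for any $d,b_0\in\mathbb N$ and $b_1,\ldots,b_{2d}\in\mathbb N_0$, the multiple series defining both sides below converge absolutely, and $$t^{\star}_{N,a}(\{2\}^{b_0},1,\{2\}^{b_1},3,\{2\}^{b_2},\ldots,\{2\}^{b_{2d-2}},1,\{2\}^{b_{2d-1}},3,\{2\}^{b_{2d}})=\frac{2^{2d+1}N}{B\left(\frac aN,\frac aN\right)}\,\widetilde t^{\,1/2}_{N,a}\left(2b_0+1,\overline{2b_1+2},\ldots,\overline{2b_{2d-1}+2},2b_{2d}+2\right).$$ -/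

import Mathlib

noncomputable section

namespace LevelN

/-- The summand `1 / ((N k₁ + a)^{s₁} ⋯ (N k_u + a)^{s_u})` of the multiple `t`-star value. -/
def starTerm (N a : ℕ) (s : List ℕ) (k : Fin s.length → ℕ) : ℝ :=
  ∏ i : Fin s.length, 1 / ((N : ℝ) * (k i : ℝ) + (a : ℝ)) ^ s.get i

/-- The multiple `t`-star value of level `N`,
`t^⋆_{N,a}(s₁, …, s_u) = ∑_{k₁ ≥ ⋯ ≥ k_u ≥ 0} 1 / ((N k₁ + a)^{s₁} ⋯ (N k_u + a)^{s_u})`.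
For the empty index this is `1`. -/
def tStar (N a : ℕ) (s : List ℕ) : ℝ :=
  ∑' k : {k : Fin s.length → ℕ // Antitone k}, starTerm N a s k.1

/-- The rising factorial `(x)_n = x (x + 1) ⋯ (x + n - 1)`. -/
def rising (x : ℝ) (n : ℕ) : ℝ :=
  (ascPochhammer ℝ n).eval x

/-- The last entry `k_u` of the summation index (`0` when there is no entry). -/
def lastEntry {u : ℕ} (k : Fin u → ℕ) : ℕ :=
  if h : 0 < u then k ⟨u - 1, Nat.sub_lt h Nat.one_pos⟩ else 0

/-- The summand of the alternating multiple `t`-value with Pochhammer factor. -/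
def altTerm (N a : ℕ) (s : List ℤ) (k : Fin s.length → ℕ) : ℝ :=
  (∏ i : Fin s.length,
      (((s.get i).sign : ℤ) : ℝ) ^ k i /
        ((N : ℝ) * (k i : ℝ) + (a : ℝ)) ^ (s.get i).natAbs) *
    (rising (2 * (a : ℝ) / (N : ℝ)) (lastEntry k) / ((lastEntry k).factorial : ℝ))

/-- The alternating multiple `t`-value of level `N` with factorial and Pochhammer symbols,
`t̃_{N,a}(s₁, …, s_u) = ∑_{k₁ > ⋯ > k_u ≥ 0}
  ∏ᵢ sign(sᵢ)^{kᵢ} / (N kᵢ + a)^{|sᵢ|} · (2a/N)_{k_u} / k_u!`.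
An entry `-m` with `m > 0` stands for the barred entry `m`. -/
def tTilde (N a : ℕ) (s : List ℤ) : ℝ :=
  ∑' k : {k : Fin s.length → ℕ // StrictAnti k}, altTerm N a s k.1

/-- The signed addition of two nonzero integers: absolute values add, signs multiply. -/
def signedAdd (s l : ℤ) : ℤ :=
  if 0 < s * l then |s| + |l| else -(|s| + |l|)

/-- All ways of replacing each separator `∘` in `s₁ ∘ s₂ ∘ ⋯ ∘ s_u` by a plus (signed addition)
or a comma. Each choice appears once, as the pair of its number of pluses and the
resulting index. -/
def choices : List ℤ → List (ℕ × List ℤ)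
  | [] => [(0, [])]
  | [s] => [(0, [s])]
  | s :: l :: rest =>
      (choices (signedAdd s l :: rest)).map (fun p => (p.1 + 1, p.2)) ++
        (choices (l :: rest)).map (fun p => (p.1, s :: p.2))
termination_by s => s.length

/-- The interpolated alternating multiple `t`-value
`t̃^r_{N,a}(s₁, …, s_u) = ∑_{∘ = plus or comma} r^{number of pluses} t̃_{N,a}(s₁ ∘ ⋯ ∘ s_u)`. -/
def tTildeInterp (N a : ℕ) (r : ℝ) (s : List ℤ) : ℝ :=
  ((choices s).map (fun p => r ^ p.1 * tTilde N a p.2)).sum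

/-- The index `({2}^{b₀}, c₁, {2}^{b₁}, …, c_m, {2}^{b_m})`, where `c_{i+1}` is `c i`. -/
def twosIndex (m : ℕ) (c b : ℕ → ℕ) : List ℕ :=
  List.replicate (b 0) 2 ++
    (List.range m).flatMap (fun i => c i :: List.replicate (b (i + 1)) 2)

/-- The sequence `1, 3, 1, 3, …`. -/
def oneThree (i : ℕ) : ℕ := if Even i then 1 else 3

/-- The index `(2b₀+1, bar(2b₁+2), …, bar(2b_{2d-1}+2), 2b_{2d}+2)` for `d ≥ 1`. -/
def evalIndex (d : ℕ) (b : ℕ → ℕ) : List ℤ :=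
  (2 * (b 0 : ℤ) + 1) ::
    ((List.range (2 * d - 1)).map (fun i => -(2 * (b (i + 1) : ℤ) + 2)) ++
      [2 * (b (2 * d) : ℤ) + 2])

end LevelN

end

/-!
Write `x_k = N k + a` and `w_k = (2a/N)_k / k!`. The truncated star sums `S_n(s)` (those with
`k₁ ≤ n`) all have an expansion `S_n(s) = ∑_{k ≤ n} K(n, k) g_k`, where `K(n, k)` is, up to the
factor `(-1)^k w_k / x_k`, the partial fraction coefficient of `∏_{j ≤ n} (1 - z² / x_j²)⁻¹` at
`z² = x_k²`. The kernel satisfies two first order recursions,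

* in `n` (`kernel_succ_left`): `x_{n+1}² K(n, k) = (x_{n+1}² - x_k²) K(n + 1, k)`,
* in `k` (`kernel_succ_right`): `(x_n + x_{k+1}) K(n, k + 1) = (x_n - x_k) K(n, k)`.

The empty index has coefficients `(-1)^k w_k / x_k` (`kernelSum_one`). With
`I(g)_j = ∑_{k < j} g_k + g_j / 2`, prepending an entry to the index changes the coefficients by

* `2`: `g_k ↦ g_k / x_k²` (`starTrunc_two`), from the recursion in `n`;
* `1`: `g_k ↦ 2 I(g)_k / x_k` (`starTrunc_one`) and
  `3`: `g_k ↦ 2 (-1)^k I((-1)^j g_j / x_j)_k / x_k²` (`starTrunc_three`), from both recursions and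
  summation by parts.

Iterating this over the index `{2}^{b₀}, 1, {2}^{b₁}, 3, …` produces iterated half-weighted partial
sums (`starTrunc_twosIndex`). The weight `1/2` on the diagonal is what the interpolation at `r = 1/2`
does when a plus merges two entries, so the coefficients are `2^{2d}` times the part of the
interpolated sum with `k₁ = k` (`sum_choices_slice`).

Finally `n → ∞`: `K(n, k)` is bounded and tends to `2N / B(a/N, a/N)` for each `k`
(`tendsto_kernel`, by Gauss's limit for the Gamma function). The interpolated sums converge
absolutely because `w_k ≤ k + 1` (`summable_altTerm`), so dominated convergence gives the
evaluation; as the terms of the star sum are nonnegative, it also gives their summability.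
-/

noncomputable section

namespace LevelN

open Finset Filter Topology

/-! ### Chains of indices -/

/-- The functions `k : Fin u → ℕ` with `k₀ < n` and `kᵢ₊₁ < β kᵢ` for all `i`. With `β m = m + 1`
these are the antitone functions below `n`, with `β m = m` the strictly antitone ones. -/
def chains (β : ℕ → ℕ) : (u : ℕ) → ℕ → Finset (Fin u → ℕ)
  | 0, _ => univ
  | u + 1, n => ((range n).sigma fun m => chains β u (β m)).map
      ⟨fun p => (Fin.cons p.1 p.2 : Fin (u + 1) → ℕ), by
        rintro ⟨m, k⟩ ⟨m', k'⟩ h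
        obtain ⟨h₁, h₂⟩ := Fin.cons_injective2 h
        subst h₁ h₂
        rfl⟩

lemma sum_chains_succ (β : ℕ → ℕ) (u n : ℕ) (F : (Fin (u + 1) → ℕ) → ℝ) :
    ∑ k ∈ chains β (u + 1) n, F k =
      ∑ m ∈ range n, ∑ k ∈ chains β u (β m), F (Fin.cons m k) := by
  rw [chains, sum_map, sum_sigma]
  rfl

lemma cons_mem_chains {β : ℕ → ℕ} {u n m : ℕ} {k : Fin u → ℕ} :
    (Fin.cons m k : Fin (u + 1) → ℕ) ∈ chains β (u + 1) n ↔ m < n ∧ k ∈ chains β u (β m) := by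
  rw [chains, Finset.mem_map]
  constructor
  · rintro ⟨⟨m', k'⟩, h, h'⟩
    have h'' : (Fin.cons m' k' : Fin (u + 1) → ℕ) = Fin.cons m k := h'
    obtain ⟨h₁, h₂⟩ := Fin.cons_injective2 h''
    subst h₁ h₂
    simpa using h
  · rintro ⟨h₁, h₂⟩
    exact ⟨⟨m, k⟩, by simpa using ⟨h₁, h₂⟩, rfl⟩

lemma mem_chains_succ_iff {u n : ℕ} {k : Fin u → ℕ} :
    k ∈ chains (· + 1) u n ↔ Antitone k ∧ ∀ i, k i < n := by
  induction u generalizing n with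
  | zero => exact ⟨fun _ => ⟨Subsingleton.antitone k, fun i => i.elim0⟩, fun _ => mem_univ k⟩
  | succ u ih =>
    obtain ⟨m, k, rfl⟩ : ∃ m k', k = (Fin.cons m k' : Fin (u + 1) → ℕ) :=
      ⟨k 0, Fin.tail k, (Fin.cons_self_tail k).symm⟩
    rw [cons_mem_chains, ih]
    constructor
    · rintro ⟨hm, hk, hkm⟩
      refine ⟨?_, fun i => ?_⟩
      · intro i j hij
        cases i using Fin.cases with
        | zero =>
          cases j using Fin.cases with
          | zero => simp
          | succ j => simpa using Nat.lt_succ_iff.1 (hkm j)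
        | succ i =>
          cases j using Fin.cases with
          | zero => simp at hij
          | succ j => simpa using hk (Fin.succ_le_succ_iff.1 hij)
      · cases i using Fin.cases with
        | zero => simpa using hm
        | succ i => have := hkm i; simp; omega
    · rintro ⟨hk, hkn⟩
      refine ⟨by simpa using hkn 0, fun i j hij => ?_, fun i => ?_⟩
      · simpa using hk (Fin.succ_le_succ_iff.2 hij)
      · have := hk (Fin.zero_le i.succ)
        simp at this; omega

lemma mem_chains_id_iff {u n : ℕ} {k : Fin u → ℕ} :
    k ∈ chains id u n ↔ StrictAnti k ∧ ∀ i, k i < n := by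
  induction u generalizing n with
  | zero => exact ⟨fun _ => ⟨Subsingleton.strictAnti k, fun i => i.elim0⟩, fun _ => mem_univ k⟩
  | succ u ih =>
    obtain ⟨m, k, rfl⟩ : ∃ m k', k = (Fin.cons m k' : Fin (u + 1) → ℕ) :=
      ⟨k 0, Fin.tail k, (Fin.cons_self_tail k).symm⟩
    rw [cons_mem_chains, ih]
    constructor
    · rintro ⟨hm, hk, hkm⟩
      refine ⟨?_, fun i => ?_⟩
      · intro i j hij
        cases i using Fin.cases with
        | zero =>
          cases j using Fin.cases with
          | zero => simp at hij
          | succ j => simpa using hkm j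
        | succ i =>
          cases j using Fin.cases with
          | zero => simp at hij
          | succ j => simpa using hk (Fin.succ_lt_succ_iff.1 hij)
      · cases i using Fin.cases with
        | zero => simpa using hm
        | succ i => have := hkm i; simp at this ⊢; omega
    · rintro ⟨hk, hkn⟩
      refine ⟨by simpa using hkn 0, fun i j hij => ?_, fun i => ?_⟩
      · simpa using hk (Fin.succ_lt_succ_iff.2 hij)
      · have := hk (Fin.succ_pos i)
        simpa using this

/-- A sequence of finsets of functions that bounds all values by `n` and contains every
admissible function exhausts the admissible functions. -/
lemma tendsto_subtype_atTop {u : ℕ} {p : (Fin u → ℕ) → Prop} [DecidablePred p]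
    {C : ℕ → Finset (Fin u → ℕ)} (hC : ∀ n k, k ∈ C n ↔ p k ∧ ∀ i, k i < n) :
    Tendsto (fun n => (C n).subtype p) atTop atTop := by
  refine tendsto_atTop_finset_of_monotone (fun n n' h k hk => ?_) (fun k => ?_)
  · rw [mem_subtype, hC] at hk ⊢
    exact ⟨hk.1, fun i => (hk.2 i).trans_le h⟩
  · refine ⟨(∑ i, k.1 i) + 1, ?_⟩
    rw [mem_subtype, hC]
    exact ⟨k.2, fun i => Nat.lt_succ_of_le (single_le_sum (fun _ _ => Nat.zero_le _) (mem_univ i))⟩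

lemma sum_subtype_of_bounded {u : ℕ} {p : (Fin u → ℕ) → Prop} [DecidablePred p]
    {C : ℕ → Finset (Fin u → ℕ)} (hC : ∀ n k, k ∈ C n ↔ p k ∧ ∀ i, k i < n)
    (F : (Fin u → ℕ) → ℝ) (n : ℕ) :
    ∑ k ∈ (C n).subtype p, F k.1 = ∑ k ∈ C n, F k :=
  sum_subtype_of_mem F fun k hk => ((hC n k).1 hk).1

/-! ### Nodes, weights and the kernel -/

/-- The denominators `N k + a`. -/
def node (N a k : ℕ) : ℝ := (N : ℝ) * (k : ℝ) + (a : ℝ)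

/-- The Pochhammer factor `(2a/N)_k / k!`. -/
def weight (N a k : ℕ) : ℝ := rising (2 * (a : ℝ) / (N : ℝ)) k / (k.factorial : ℝ)

/-- The kernel that expands truncated star sums. Up to the factor `(-1)^k w_k / x_k`, with `x` the
nodes and `w` the weights, it is the partial fraction coefficient `∏_{j ≤ n, j ≠ k} x_j² / (x_j² - x_k²)`
of `∏_{j ≤ n} (1 - z² / x_j²)⁻¹` at `z² = x_k²`. It vanishes for `k > n`. -/
def kernel (N a n k : ℕ) : ℝ :=
  (a * ∏ i ∈ range n, node N a (i + 1) ^ 2 / (node N a (i + 1) ^ 2 - node N a 0 ^ 2)) *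
    ∏ i ∈ range k, (node N a n - node N a i) / (node N a n + node N a (i + 1))

section

variable {N a : ℕ}

lemma node_pos (ha : 1 ≤ a) (k : ℕ) : 0 < node N a k := by
  have : (0 : ℝ) < a := by exact_mod_cast ha
  unfold node; positivity

lemma node_zero : node N a 0 = a := by simp [node]

lemma node_mono {j k : ℕ} (h : j ≤ k) : node N a j ≤ node N a k := by
  unfold node; gcongr

lemma node_lt (hN : 1 ≤ N) {j k : ℕ} (h : j < k) : node N a j < node N a k := by
  have : (0 : ℝ) < N := by exact_mod_cast hN
  unfold node; gcongr

lemma weight_zero : weight N a 0 = 1 := by simp [weight, rising]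

lemma weight_succ (hN : 1 ≤ N) (k : ℕ) :
    (k + 1) * weight N a (k + 1) = (2 * a / N + k) * weight N a k := by
  have : (k.factorial : ℝ) ≠ 0 := by positivity
  rw [weight, weight, rising, rising, ascPochhammer_succ_right, Nat.factorial_succ]
  simp only [Polynomial.eval_mul, Polynomial.eval_add, Polynomial.eval_X, Polynomial.eval_natCast]
  push_cast
  field_simp

lemma weight_nonneg (k : ℕ) : 0 ≤ weight N a k := by
  induction k with
  | zero => simp [weight_zero]
  | succ k ih =>
    rcases Nat.eq_zero_or_pos N with rfl | hN
    · simp [weight, rising]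
    · have h := weight_succ (a := a) hN k
      have h' : 0 ≤ ((k : ℝ) + 1) * weight N a (k + 1) := by rw [h]; positivity
      exact nonneg_of_mul_nonneg_right h' (by positivity)

/-- Since `2a/N ≤ 2`, the weight is at most `(2)_k / k! = k + 1`. -/
lemma weight_le (hN : 1 ≤ N) (haN : a ≤ N) (k : ℕ) : weight N a k ≤ k + 1 := by
  induction k with
  | zero => simp [weight_zero]
  | succ k ih =>
    have h := weight_succ (a := a) hN k
    have hN' : (0 : ℝ) < N := by exact_mod_cast hN
    have haN' : (a : ℝ) ≤ N := by exact_mod_cast haN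
    have h2 : 2 * (a : ℝ) / N ≤ 2 := by rw [div_le_iff₀ hN']; linarith
    have h3 : (2 * (a : ℝ) / N + k) * weight N a k ≤ (2 + k) * (k + 1) := by
      have := weight_nonneg (N := N) (a := a) k
      gcongr
    rw [← h] at h3
    push_cast
    have hk : (0 : ℝ) < k + 1 := by positivity
    nlinarith

/-- The recursion of the kernel in `k`. -/
lemma kernel_succ_right (ha : 1 ≤ a) (n k : ℕ) :
    (node N a n + node N a (k + 1)) * kernel N a n (k + 1) =
      (node N a n - node N a k) * kernel N a n k := by
  have h : node N a n + node N a (k + 1) ≠ 0 := (add_pos (node_pos ha _) (node_pos ha _)).ne'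
  rw [kernel, kernel, prod_range_succ]
  field_simp

lemma kernel_eq_zero {n k : ℕ} (h : n < k) : kernel N a n k = 0 := by
  rw [kernel, prod_eq_zero (i := n) (mem_range.2 h) (by simp), mul_zero]

/-- The recursion of the kernel in `n`, proved by induction on `k`: the node differences and sums in
`kernel_succ_right` for `n` and `n + 1` are related because the nodes form an arithmetic progression. -/
lemma kernel_succ_left (ha : 1 ≤ a) (hN : 1 ≤ N) (n k : ℕ) :
    node N a (n + 1) ^ 2 * kernel N a n k =
      (node N a (n + 1) ^ 2 - node N a k ^ 2) * kernel N a (n + 1) k := by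
  induction k with
  | zero =>
    have h : node N a (n + 1) ^ 2 - node N a 0 ^ 2 ≠ 0 := by
      have := node_lt (a := a) hN (Nat.succ_pos n)
      have := node_pos (N := N) ha 0
      simp only [Nat.succ_eq_add_one] at *
      nlinarith
    simp only [kernel, prod_range_succ, range_zero, prod_empty, mul_one]
    field_simp
  | succ k ih =>
    have e₁ := kernel_succ_right (N := N) ha n k
    have e₂ := kernel_succ_right (N := N) ha (n + 1) k
    have h : node N a n + node N a (k + 1) ≠ 0 := (add_pos (node_pos ha _) (node_pos ha _)).ne'
    have hs : node N a (n + 1) + node N a k = node N a n + node N a (k + 1) := by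
      unfold node; push_cast; ring
    have hd : node N a (n + 1) - node N a (k + 1) = node N a n - node N a k := by
      unfold node; push_cast; ring
    apply mul_left_cancel₀ h
    calc _ = (node N a n - node N a k) * (node N a (n + 1) ^ 2 * kernel N a n k) := by
            linear_combination node N a (n + 1) ^ 2 * e₁
      _ = _ := by
            rw [ih]
            linear_combination (-(node N a n - node N a k) * (node N a (n + 1) + node N a k)) * e₂ +
              (node N a n - node N a k) * (node N a (n + 1) + node N a (k + 1)) *
                kernel N a (n + 1) (k + 1) * hs - (node N a n + node N a (k + 1)) *
                (node N a (n + 1) + node N a (k + 1)) * kernel N a (n + 1) (k + 1) * hd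

lemma kernel_zero_zero : kernel N a 0 0 = a := by simp [kernel]

lemma kernel_zero_right_nonneg (hN : 1 ≤ N) (n : ℕ) : 0 ≤ kernel N a n 0 := by
  simp only [kernel, range_zero, prod_empty, mul_one]
  refine mul_nonneg (Nat.cast_nonneg _) (prod_nonneg fun i _ => div_nonneg (sq_nonneg _) ?_)
  have h₁ := node_lt (a := a) hN (Nat.succ_pos i)
  have h₂ : 0 ≤ node N a 0 := by simp [node_zero]
  exact sub_nonneg.2 (pow_le_pow_left₀ h₂ h₁.le 2)

lemma abs_kernel_le (ha : 1 ≤ a) (hN : 1 ≤ N) (n k : ℕ) :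
    |kernel N a n k| ≤ kernel N a n 0 := by
  induction k with
  | zero => exact (abs_of_nonneg (kernel_zero_right_nonneg hN n)).le
  | succ k ih =>
    rcases lt_or_ge n (k + 1) with h | h
    · rw [kernel_eq_zero h, abs_zero]; exact kernel_zero_right_nonneg hN n
    · have h₀ : 0 < node N a n + node N a (k + 1) := add_pos (node_pos ha _) (node_pos ha _)
      have h₁ := node_mono (N := N) (a := a) (show k ≤ n by omega)
      have h₂ := node_pos (N := N) ha k
      have h₃ := node_pos (N := N) ha (k + 1)
      have e : (node N a n + node N a (k + 1)) * |kernel N a n (k + 1)| =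
          (node N a n - node N a k) * |kernel N a n k| := by
        rw [← abs_of_pos h₀, ← abs_mul, kernel_succ_right ha, abs_mul,
          abs_of_nonneg (sub_nonneg.2 h₁)]
      refine le_trans (le_of_mul_le_mul_left ?_ h₀) ih
      rw [e]
      exact mul_le_mul_of_nonneg_right (by linarith) (abs_nonneg _)

lemma kernel_zero_right_eq (ha : 1 ≤ a) (hN : 1 ≤ N) (n : ℕ) :
    kernel N a n 0 = 2 * N * (∏ j ∈ range (n + 1), ((a : ℝ) / N + j)) ^ 2 /
      (n.factorial * ∏ j ∈ range (n + 1), (2 * ((a : ℝ) / N) + j)) := by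
  have hN' : (0 : ℝ) < N := by exact_mod_cast hN
  have ha' : (0 : ℝ) < a := by exact_mod_cast ha
  induction n with
  | zero =>
    rw [kernel_zero_zero]
    simp
    field_simp
  | succ n ih =>
    have hp : ∏ j ∈ range (n + 1), (2 * ((a : ℝ) / N) + j) ≠ 0 :=
      (prod_pos fun j _ => by positivity).ne'
    have hf : (n.factorial : ℝ) ≠ 0 := by positivity
    have e := kernel_succ_left ha hN n 0
    have hx : node N a (n + 1) ^ 2 - node N a 0 ^ 2 =
        N ^ 2 * ((n + 1) * (2 * ((a : ℝ) / N) + (n + 1))) := by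
      unfold node; push_cast; field_simp; ring
    have hx' : node N a (n + 1) = N * ((a : ℝ) / N + (n + 1)) := by
      unfold node; push_cast; field_simp; ring
    rw [hx, ih, hx'] at e
    have h0 : (N : ℝ) ^ 2 * ((n + 1) * (2 * ((a : ℝ) / N) + (n + 1))) ≠ 0 := by positivity
    apply mul_left_cancel₀ h0
    have h1 : 2 * ((a : ℝ) / N) + (n + 1) ≠ 0 := by positivity
    rw [← e, prod_range_succ _ (n + 1), prod_range_succ _ (n + 1), Nat.factorial_succ]
    push_cast
    generalize (∏ j ∈ range (n + 1), ((a : ℝ) / N + j)) = A at *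
    generalize (∏ j ∈ range (n + 1), (2 * ((a : ℝ) / N) + j)) = B at *
    generalize (a : ℝ) / N = α at *
    generalize hc : 2 * α + ((n : ℝ) + 1) = c at *
    field_simp

/-- `K(n, 0)` is `2N` times the ratio of the Gauss sequences for `Γ(2α)` and `Γ(α)²` with
`α = a/N`. -/
lemma tendsto_kernel_zero_right (ha : 1 ≤ a) (hN : 1 ≤ N) :
    Tendsto (fun n => kernel N a n 0) atTop
      (𝓝 (2 * N / ProbabilityTheory.beta ((a : ℝ) / N) ((a : ℝ) / N))) := by
  have hN' : (0 : ℝ) < N := by exact_mod_cast hN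
  have ha' : (0 : ℝ) < a := by exact_mod_cast ha
  have hα : (0 : ℝ) < a / N := by positivity
  have hG := (Real.Gamma_pos_of_pos hα).ne'
  have h := (((Real.GammaSeq_tendsto_Gamma (2 * ((a : ℝ) / N))).div
    ((Real.GammaSeq_tendsto_Gamma ((a : ℝ) / N)).pow 2) (pow_ne_zero 2 hG)).const_mul (2 * (N : ℝ)))
  have hlim : 2 * N / ProbabilityTheory.beta ((a : ℝ) / N) ((a : ℝ) / N) =
      2 * N * (Real.Gamma (2 * ((a : ℝ) / N)) / Real.Gamma ((a : ℝ) / N) ^ 2) := by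
    have hG2 := (Real.Gamma_pos_of_pos (show (0 : ℝ) < 2 * (a / N) by positivity)).ne'
    rw [ProbabilityTheory.beta, ← two_mul]
    field_simp
  rw [hlim]
  refine h.congr' ?_
  -- At `n = 0` the powers `n ^ s` of the Gauss sequences vanish and do not cancel.
  filter_upwards [eventually_ge_atTop 1] with n hn
  have hn' : (0 : ℝ) < n := by exact_mod_cast hn
  have hp : ∏ j ∈ range (n + 1), (2 * ((a : ℝ) / N) + j) ≠ 0 :=
    (prod_pos fun j _ => by positivity).ne'
  have hp' : ∏ j ∈ range (n + 1), ((a : ℝ) / N + j) ≠ 0 :=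
    (prod_pos fun j _ => by positivity).ne'
  have hf : (n.factorial : ℝ) ≠ 0 := by positivity
  have hr := (Real.rpow_pos_of_pos hn' ((a : ℝ) / N)).ne'
  simp only [Pi.div_apply]
  rw [kernel_zero_right_eq ha hN, Real.GammaSeq, Real.GammaSeq, two_mul ((a : ℝ) / N),
    Real.rpow_add hn', ← two_mul ((a : ℝ) / N)]
  generalize (∏ j ∈ range (n + 1), ((a : ℝ) / N + j)) = A at *
  generalize (∏ j ∈ range (n + 1), (2 * ((a : ℝ) / N) + j)) = B at *
  field_simp

/-- The limit does not depend on `k`, because the ratio of consecutive kernel values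
`(x_n - x_k) / (x_n + x_{k+1})` tends to `1`. -/
lemma tendsto_kernel (ha : 1 ≤ a) (hN : 1 ≤ N) (k : ℕ) :
    Tendsto (fun n => kernel N a n k) atTop
      (𝓝 (2 * N / ProbabilityTheory.beta ((a : ℝ) / N) ((a : ℝ) / N))) := by
  induction k with
  | zero => exact tendsto_kernel_zero_right ha hN
  | succ k ih =>
    have hN' : (0 : ℝ) < N := by exact_mod_cast hN
    have hx : Tendsto (fun n => node N a n + node N a (k + 1)) atTop atTop := by
      unfold node
      exact tendsto_atTop_add_const_right _ _ (tendsto_atTop_add_const_right _ _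
        (tendsto_natCast_atTop_atTop.const_mul_atTop hN'))
    have hr : Tendsto (fun n => 1 - (node N a k + node N a (k + 1)) /
        (node N a n + node N a (k + 1))) atTop (𝓝 (1 - 0)) :=
      tendsto_const_nhds.sub (hx.const_div_atTop _)
    have := hr.mul ih
    rw [sub_zero, one_mul] at this
    refine this.congr fun n => ?_
    have h : node N a n + node N a (k + 1) ≠ 0 := (add_pos (node_pos ha _) (node_pos ha _)).ne'
    have e := kernel_succ_right (N := N) ha n k
    apply mul_left_cancel₀ h
    rw [e]
    field_simp
    ring

/-! ### Kernel expansions of truncated star sums -/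

/-- The truncation `k₁ ≤ n` of the sum `t^⋆_{N,a}(s)`. -/
def starTrunc (N a : ℕ) : List ℕ → ℕ → ℝ
  | [], _ => 1
  | s :: t, n => ∑ m ∈ range (n + 1), 1 / node N a m ^ s * starTrunc N a t m

/-- The sum of `g` against the kernel. -/
def kernelSum (N a : ℕ) (g : ℕ → ℝ) (n : ℕ) : ℝ :=
  ∑ k ∈ range (n + 1), kernel N a n k * g k

/-- The partial sum of `g` over `k ≤ j` in which the last term has weight `1/2`. -/
def halfSum (g : ℕ → ℝ) (j : ℕ) : ℝ := ∑ k ∈ range j, g k + g j / 2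

lemma halfSum_const_mul (c : ℝ) (g : ℕ → ℝ) (j : ℕ) :
    halfSum (fun k => c * g k) j = c * halfSum g j := by
  simp only [halfSum, ← mul_sum]; ring

/-- The form of the half-weighted sum in which summation by parts telescopes. -/
lemma two_mul_halfSum (g : ℕ → ℝ) (j : ℕ) :
    2 * halfSum g j = ∑ k ∈ range j, g k + ∑ k ∈ range (j + 1), g k := by
  rw [halfSum, sum_range_succ]; ring

lemma kernelSum_succ_sub (ha : 1 ≤ a) (hN : 1 ≤ N) (g : ℕ → ℝ) (n : ℕ) :
    node N a (n + 1) ^ 2 * (kernelSum N a g (n + 1) - kernelSum N a g n) =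
      ∑ k ∈ range (n + 2), kernel N a (n + 1) k * (node N a k ^ 2 * g k) := by
  have h : kernelSum N a g n = ∑ k ∈ range (n + 2), kernel N a n k * g k := by
    rw [sum_range_succ _ (n + 1), kernel_eq_zero (Nat.lt_succ_self n), zero_mul, add_zero, kernelSum]
  rw [h, kernelSum, ← sum_sub_distrib, mul_sum]
  refine sum_congr rfl fun k _ => ?_
  linear_combination (-g k) * kernel_succ_left ha hN n k

/-- Multiplication of the coefficients by `x_k²` corresponds to the difference operator
`F ↦ x_n² (F n - F (n - 1))`. -/
lemma sum_eq_kernelSum (ha : 1 ≤ a) (hN : 1 ≤ N) {F g : ℕ → ℝ}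
    (h : ∀ n, node N a n ^ 2 * F n = kernelSum N a (fun k => node N a k ^ 2 * g k) n) (n : ℕ) :
    ∑ m ∈ range (n + 1), F m = kernelSum N a g n := by
  have h0 (n : ℕ) : node N a n ^ 2 ≠ 0 := pow_ne_zero 2 (node_pos ha n).ne'
  induction n with
  | zero =>
    apply mul_left_cancel₀ (h0 0)
    rw [zero_add, sum_range_one, h]
    simp [kernelSum]
    ring
  | succ n ih =>
    apply mul_left_cancel₀ (h0 (n + 1))
    have e := kernelSum_succ_sub ha hN g n
    have e' := h (n + 1)
    rw [kernelSum, ← e] at e'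
    rw [sum_range_succ, ih]
    linear_combination e'

/-- The partial fraction expansion of the constant `1`. -/
lemma kernelSum_one (ha : 1 ≤ a) (hN : 1 ≤ N) (n : ℕ) :
    kernelSum N a (fun k => (-1) ^ k * weight N a k / node N a k) n = 1 := by
  have hN' : (0 : ℝ) < N := by exact_mod_cast hN
  induction n with
  | zero =>
    have : (a : ℝ) ≠ 0 := by positivity
    simp [kernelSum, kernel_zero_zero, weight_zero, node_zero, this]
  | succ n ih =>
    -- The increment `∑ K(n + 1, k) x_k² g_k` has closed partial sums, which vanish at `m = n + 2`
    -- since `K(n + 1, n + 2) = 0`.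
    have key (m : ℕ) : 2 * (n + 1) * ∑ k ∈ range m, kernel N a (n + 1) k *
        (node N a k ^ 2 * ((-1) ^ k * weight N a k / node N a k)) =
        -(-1) ^ m * m * weight N a m * (node N a (n + 1) + node N a m) * kernel N a (n + 1) m := by
      induction m with
      | zero => simp
      | succ m ihm =>
        have hm := (node_pos (N := N) ha m).ne'
        have e := kernel_succ_right (N := N) ha (n + 1) m
        have e' := weight_succ (a := a) hN m
        have hx : (2 * a / N + m) * (node N a (n + 1) - node N a m) +
            m * (node N a (n + 1) + node N a m) = 2 * (n + 1) * node N a m := by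
          unfold node; push_cast; field_simp; ring
        have hq : node N a m ^ 2 * ((-1) ^ m * weight N a m / node N a m) =
            (-1) ^ m * weight N a m * node N a m := by field_simp
        rw [sum_range_succ, mul_add, ihm, hq, pow_succ]
        push_cast
        linear_combination (-(-1) ^ m * (m + 1) * weight N a (m + 1)) * e -
          (-1) ^ m * (node N a (n + 1) - node N a m) * kernel N a (n + 1) m * e' -
          (-1) ^ m * weight N a m * kernel N a (n + 1) m * hx
    have h := key (n + 2)
    rw [kernel_eq_zero (show n + 1 < n + 2 by omega), mul_zero,
      ← kernelSum_succ_sub ha hN] at h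
    have h0 : 2 * ((n : ℝ) + 1) ≠ 0 := by positivity
    have h1 := (mul_eq_zero.1 ((mul_eq_zero.1 h).resolve_left h0)).resolve_left
      (pow_ne_zero 2 (node_pos ha (n + 1)).ne')
    linarith

lemma starTrunc_two (ha : 1 ≤ a) (hN : 1 ≤ N) {t : List ℕ} {g : ℕ → ℝ}
    (h : ∀ n, starTrunc N a t n = kernelSum N a g n) (n : ℕ) :
    starTrunc N a (2 :: t) n = kernelSum N a (fun k => g k / node N a k ^ 2) n := by
  rw [starTrunc]
  refine sum_eq_kernelSum ha hN (fun m => ?_) n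
  have hm := (node_pos (N := N) ha m).ne'
  rw [h, kernelSum, kernelSum, ← mul_assoc, mul_one_div_cancel (pow_ne_zero 2 hm), one_mul]
  refine sum_congr rfl fun k _ => ?_
  rw [mul_div_cancel₀ _ (pow_ne_zero 2 (node_pos ha k).ne')]

/-- Summation by parts: the difference of the two sides telescopes by the recursion of the kernel
in `k`. -/
lemma node_mul_kernelSum (ha : 1 ≤ a) (g : ℕ → ℝ) (n : ℕ) :
    node N a n * kernelSum N a g n =
      kernelSum N a (fun k => node N a k * (2 * halfSum g k)) n := by
  have key (m : ℕ) : node N a n * ∑ k ∈ range m, kernel N a n k * g k =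
      ∑ k ∈ range m, kernel N a n k * (node N a k * (2 * halfSum g k)) +
        (node N a n + node N a m) * kernel N a n m * ∑ k ∈ range m, g k := by
    induction m with
    | zero => simp
    | succ m ih =>
      rw [sum_range_succ, sum_range_succ _ m, mul_add, ih, two_mul_halfSum, sum_range_succ g,
        kernel_succ_right ha]
      ring
  rw [kernelSum, key, kernel_eq_zero (Nat.lt_succ_self n), mul_zero, zero_mul, add_zero, kernelSum]

/-- The alternating companion of `node_mul_kernelSum`. -/
lemma kernelSum_alternating (ha : 1 ≤ a) (g : ℕ → ℝ) (n : ℕ) :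
    kernelSum N a (fun k => (-1) ^ k * (node N a k * g k)) n =
      node N a n * kernelSum N a (fun k => (-1) ^ k * (2 * halfSum g k)) n := by
  have key (m : ℕ) : ∑ k ∈ range m, kernel N a n k * ((-1) ^ k * (node N a k * g k)) =
      node N a n * ∑ k ∈ range m, kernel N a n k * ((-1) ^ k * (2 * halfSum g k)) +
        (-1) ^ m * (node N a n + node N a m) * kernel N a n m * ∑ k ∈ range m, g k := by
    induction m with
    | zero => simp
    | succ m ih =>
      rw [sum_range_succ, sum_range_succ _ m, mul_add, ih, two_mul_halfSum, sum_range_succ g,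
        mul_assoc ((-1) ^ (m + 1)), kernel_succ_right ha]
      ring
  rw [kernelSum, key, kernel_eq_zero (Nat.lt_succ_self n), mul_zero, zero_mul, add_zero, kernelSum]

lemma starTrunc_one (ha : 1 ≤ a) (hN : 1 ≤ N) {t : List ℕ} {g : ℕ → ℝ}
    (h : ∀ n, starTrunc N a t n = kernelSum N a g n) (n : ℕ) :
    starTrunc N a (1 :: t) n = kernelSum N a (fun k => 2 * halfSum g k / node N a k) n := by
  rw [starTrunc]
  refine sum_eq_kernelSum ha hN (fun m => ?_) n
  have hm := (node_pos (N := N) ha m).ne'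
  have e : node N a m ^ 2 * (1 / node N a m ^ 1 * kernelSum N a g m) =
      node N a m * kernelSum N a g m := by field_simp
  rw [h, e, node_mul_kernelSum ha]
  refine sum_congr rfl fun k _ => ?_
  have hk := (node_pos (N := N) ha k).ne'
  field_simp

lemma starTrunc_three (ha : 1 ≤ a) (hN : 1 ≤ N) {t : List ℕ} {g : ℕ → ℝ}
    (h : ∀ n, starTrunc N a t n = kernelSum N a g n) (n : ℕ) :
    starTrunc N a (3 :: t) n = kernelSum N a (fun k => (-1) ^ k *
      (2 * halfSum (fun k => (-1) ^ k * g k / node N a k) k) / node N a k ^ 2) n := by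
  rw [starTrunc]
  refine sum_eq_kernelSum ha hN (fun m => ?_) n
  have hm := (node_pos (N := N) ha m).ne'
  have hg : g = fun k => (-1) ^ k * (node N a k * ((-1) ^ k * g k / node N a k)) := by
    funext k
    have hk := (node_pos (N := N) ha k).ne'
    rw [mul_div_cancel₀ _ hk, ← mul_assoc, ← mul_pow]
    simp
  rw [h]
  conv_lhs => rw [hg]
  rw [kernelSum_alternating ha]
  have e (S : ℝ) : node N a m ^ 2 * (1 / node N a m ^ 3 * (node N a m * S)) = S := by field_simp
  rw [e]
  refine sum_congr rfl fun k _ => ?_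
  beta_reduce
  rw [mul_div_cancel₀ _ (pow_ne_zero 2 (node_pos ha k).ne')]

lemma starTrunc_replicate_two (ha : 1 ≤ a) (hN : 1 ≤ N) {t : List ℕ} {g : ℕ → ℝ}
    (h : ∀ n, starTrunc N a t n = kernelSum N a g n) (b n : ℕ) :
    starTrunc N a (List.replicate b 2 ++ t) n =
      kernelSum N a (fun k => g k / node N a k ^ (2 * b)) n := by
  induction b generalizing n with
  | zero => simp [h]
  | succ b ih =>
    rw [List.replicate_succ, List.cons_append, starTrunc_two ha hN ih]
    refine sum_congr rfl fun k _ => ?_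
    beta_reduce
    rw [div_div, ← pow_add]
    rfl

/-! ### The interpolated side -/

/-- The factor `sign(s)^k / x_k^{|s|}` contributed by one entry of the index. -/
def factor (N a : ℕ) (s : ℤ) (k : ℕ) : ℝ := ((s.sign : ℤ) : ℝ) ^ k / node N a k ^ s.natAbs

/-- The interpolated inner sum with `r = 1/2`: iterated half-weighted partial sums, starting from
the Pochhammer factor. -/
def interpTail (N a : ℕ) : List ℤ → ℕ → ℝ
  | [] => weight N a
  | l :: t => halfSum (fun k => factor N a l k * interpTail N a t k)

/-- The part of `t̃_{N,a}(s)` with `k₁ = m`; the value on the empty index is a convention. -/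
def slice (N a : ℕ) : List ℤ → ℕ → ℝ
  | [], _ => 0
  | [s], m => factor N a s m * weight N a m
  | s :: l :: t, m => factor N a s m * ∑ j ∈ range m, slice N a (l :: t) j

lemma slice_cons_of_ne_nil (s : ℤ) {t : List ℤ} (ht : t ≠ []) (m : ℕ) :
    slice N a (s :: t) m = factor N a s m * ∑ j ∈ range m, slice N a t j := by
  cases t with
  | nil => exact absurd rfl ht
  | cons l t => rw [slice]

lemma factor_odd (b k : ℕ) :
    factor N a (2 * (b : ℤ) + 1) k = 1 / node N a k ^ (2 * b + 1) := by
  have h : (2 * (b : ℤ) + 1).sign = 1 := Int.sign_eq_one_of_pos (by omega)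
  rw [factor, h, show (2 * (b : ℤ) + 1).natAbs = 2 * b + 1 by omega]
  simp

lemma factor_even (b k : ℕ) :
    factor N a (2 * (b : ℤ) + 2) k = 1 / node N a k ^ (2 * b + 2) := by
  have h : (2 * (b : ℤ) + 2).sign = 1 := Int.sign_eq_one_of_pos (by omega)
  rw [factor, h, show (2 * (b : ℤ) + 2).natAbs = 2 * b + 2 by omega]
  simp

lemma factor_bar_even (b k : ℕ) :
    factor N a (-(2 * (b : ℤ) + 2)) k = (-1) ^ k / node N a k ^ (2 * b + 2) := by
  have h : (-(2 * (b : ℤ) + 2)).sign = -1 := Int.sign_eq_neg_one_of_neg (by omega)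
  rw [factor, h, show (-(2 * (b : ℤ) + 2)).natAbs = 2 * b + 2 by omega]
  simp

lemma natAbs_signedAdd (s l : ℤ) : (signedAdd s l).natAbs = s.natAbs + l.natAbs := by
  have hs := Int.natCast_natAbs s
  have hl := Int.natCast_natAbs l
  unfold signedAdd
  split_ifs <;> omega

lemma sign_signedAdd {s l : ℤ} (hs : s ≠ 0) (hl : l ≠ 0) :
    (signedAdd s l).sign = s.sign * l.sign := by
  have h1 : 0 < |s| := abs_pos.2 hs
  have h2 : 0 < |l| := abs_pos.2 hl
  rw [← Int.sign_mul]
  unfold signedAdd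
  split_ifs with h
  · rw [Int.sign_eq_one_of_pos h, Int.sign_eq_one_of_pos (by omega)]
  · have h3 : s * l < 0 := lt_of_le_of_ne (not_lt.1 h) (mul_ne_zero hs hl)
    rw [Int.sign_eq_neg_one_of_neg h3, Int.sign_eq_neg_one_of_neg (by omega)]

lemma factor_signedAdd {s l : ℤ} (hs : s ≠ 0) (hl : l ≠ 0) (k : ℕ) :
    factor N a (signedAdd s l) k = factor N a s k * factor N a l k := by
  rw [factor, factor, factor, sign_signedAdd hs hl, natAbs_signedAdd, pow_add, Int.cast_mul,
    mul_pow, mul_div_mul_comm]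

/-- The indices that occur in the interpolation keep lower bounds on the absolute values of the
first entry and of all others. -/
lemma exists_cons_of_mem_choices {c : ℕ} (hc : 2 ≤ c) {t : List ℤ} (ht : ∀ x ∈ t, 2 ≤ x.natAbs)
    {s : ℤ} (hs : c ≤ s.natAbs) {p : ℕ × List ℤ} (hp : p ∈ choices (s :: t)) :
    ∃ h t', p.2 = h :: t' ∧ c ≤ h.natAbs ∧ ∀ x ∈ t', 2 ≤ x.natAbs := by
  induction t generalizing s c p with
  | nil =>
    rw [choices, List.mem_singleton] at hp
    subst hp
    exact ⟨s, [], rfl, hs, by simp⟩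
  | cons l t ih =>
    have hl : 2 ≤ l.natAbs := ht l List.mem_cons_self
    have ht' : ∀ x ∈ t, 2 ≤ x.natAbs := fun x hx => ht x (List.mem_cons_of_mem _ hx)
    rw [choices, List.mem_append, List.mem_map, List.mem_map] at hp
    rcases hp with ⟨q, hq, rfl⟩ | ⟨q, hq, rfl⟩
    · have hsl : c ≤ (signedAdd s l).natAbs := by rw [natAbs_signedAdd]; omega
      exact ih (p := q) hc ht' hsl hq
    · obtain ⟨h, t', e, h₁, h₂⟩ := ih le_rfl ht' hl hq
      refine ⟨s, q.2, rfl, hs, ?_⟩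
      rw [e]
      simpa using ⟨h₁, h₂⟩

lemma choices_snd_ne_nil {s : ℤ} {t : List ℤ} (p : ℕ × List ℤ) (hp : p ∈ choices (s :: t)) :
    p.2 ≠ [] := by
  induction t generalizing s p with
  | nil =>
    rw [choices, List.mem_singleton] at hp
    simp [hp]
  | cons l t ih =>
    rw [choices, List.mem_append, List.mem_map, List.mem_map] at hp
    rcases hp with ⟨q, hq, rfl⟩ | ⟨q, hq, rfl⟩
    · exact ih q hq
    · simp

lemma list_sum_finset_sum {ι : Type*} (L : List ι) (S : Finset ℕ) (f : ι → ℕ → ℝ) :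
    (L.map fun p => ∑ j ∈ S, f p j).sum = ∑ j ∈ S, (L.map fun p => f p j).sum := by
  induction L with
  | nil => simp
  | cons p L ih => simp [ih, sum_add_distrib]

/-- A plus between two entries forces equality of the two summation variables, so the sum over all
choices becomes an iteration of half-weighted partial sums. -/
lemma sum_choices_slice {t : List ℤ} (ht : ∀ x ∈ t, x ≠ 0) {s : ℤ} (hs : s ≠ 0) (k : ℕ) :
    ((choices (s :: t)).map fun p => (1 / 2 : ℝ) ^ p.1 * slice N a p.2 k).sum =
      factor N a s k * interpTail N a t k := by
  induction t generalizing s k with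
  | nil => simp [choices, slice, interpTail]
  | cons l t ih =>
    have hl : l ≠ 0 := ht l List.mem_cons_self
    have ht' : ∀ x ∈ t, x ≠ 0 := fun x hx => ht x (List.mem_cons_of_mem _ hx)
    have hsl : signedAdd s l ≠ 0 := by
      have := natAbs_signedAdd s l
      omega
    rw [choices, List.map_append, List.sum_append, List.map_map, List.map_map]
    have e₁ : ((choices (signedAdd s l :: t)).map
        ((fun p : ℕ × List ℤ => (1 / 2 : ℝ) ^ p.1 * slice N a p.2 k) ∘
          fun p => (p.1 + 1, p.2))).sum =
        1 / 2 * (factor N a s k * factor N a l k * interpTail N a t k) := by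
      rw [← factor_signedAdd hs hl, ← ih ht' hsl, ← List.sum_map_mul_left]
      congr 2
      funext p
      simp only [Function.comp, pow_succ]
      ring
    have e₂ : ((choices (l :: t)).map
        ((fun p : ℕ × List ℤ => (1 / 2 : ℝ) ^ p.1 * slice N a p.2 k) ∘
          fun p => (p.1, s :: p.2))).sum =
        factor N a s k * ∑ j ∈ range k, factor N a l j * interpTail N a t j := by
      rw [← sum_congr rfl fun j _ => ih ht' hl j, ← list_sum_finset_sum, ← List.sum_map_mul_left]
      congr 1
      refine List.map_congr_left fun p hp => ?_
      simp only [Function.comp]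
      rw [slice_cons_of_ne_nil s (choices_snd_ne_nil p hp), ← mul_sum]
      ring
    rw [e₁, e₂, interpTail, halfSum]
    ring

/-! ### Expansion of the truncated star sum -/

lemma twosIndex_succ (m : ℕ) (c b : ℕ → ℕ) :
    twosIndex (m + 1) c b = List.replicate (b 0) 2 ++
      c 0 :: twosIndex m (fun i => c (i + 1)) (fun i => b (i + 1)) := by
  simp [twosIndex, List.range_succ_eq_map, List.flatMap_map]

lemma twosIndex_oneThree_succ (d : ℕ) (b : ℕ → ℕ) :
    twosIndex (2 * (d + 1)) oneThree b = List.replicate (b 0) 2 ++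
      1 :: (List.replicate (b 1) 2 ++ 3 :: twosIndex (2 * d) oneThree (fun i => b (i + 2))) := by
  have h : (fun i => oneThree (i + 1 + 1)) = oneThree := by
    funext i
    simp [oneThree, Nat.even_add_one]
  rw [show 2 * (d + 1) = 2 * d + 1 + 1 by ring, twosIndex_succ, twosIndex_succ, h]
  simp [oneThree]

/-- The tail of `evalIndex d b`. -/
def evalTail (d : ℕ) (b : ℕ → ℕ) : List ℤ :=
  (List.range (2 * d - 1)).map (fun i => -(2 * (b (i + 1) : ℤ) + 2)) ++ [2 * (b (2 * d) : ℤ) + 2]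

lemma evalTail_one (b : ℕ → ℕ) :
    evalTail 1 b = [-(2 * (b 1 : ℤ) + 2), 2 * (b 2 : ℤ) + 2] := by
  simp [evalTail]

lemma evalTail_succ {d : ℕ} (hd : 1 ≤ d) (b : ℕ → ℕ) :
    evalTail (d + 1) b = -(2 * (b 1 : ℤ) + 2) :: -(2 * (b 2 : ℤ) + 2) ::
      evalTail d (fun i => b (i + 2)) := by
  rw [evalTail, show 2 * (d + 1) - 1 = 2 * d - 1 + 1 + 1 by omega, List.range_succ_eq_map,
    List.range_succ_eq_map]
  simp [evalTail, Function.comp_def, mul_add]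

lemma two_le_natAbs_of_mem_evalTail {d : ℕ} {b : ℕ → ℕ} {x : ℤ} (hx : x ∈ evalTail d b) :
    2 ≤ x.natAbs := by
  rw [evalTail, List.mem_append, List.mem_map, List.mem_singleton] at hx
  rcases hx with ⟨i, -, rfl⟩ | rfl <;> omega

/-- Prepending `{2}^{b₀}, 1, {2}^{b₁}, 3` to an index. -/
lemma starTrunc_block (ha : 1 ≤ a) (hN : 1 ≤ N) {t : List ℕ} {g : ℕ → ℝ}
    (h : ∀ n, starTrunc N a t n = kernelSum N a g n) (b₀ b₁ n : ℕ) :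
    starTrunc N a (List.replicate b₀ 2 ++ 1 :: (List.replicate b₁ 2 ++ 3 :: t)) n =
      kernelSum N a (fun k => 4 * (factor N a (2 * (b₀ : ℤ) + 1) k *
        halfSum (fun k => factor N a (-(2 * (b₁ : ℤ) + 2)) k *
          halfSum (fun k => (-1) ^ k * g k / node N a k) k) k)) n := by
  rw [starTrunc_replicate_two ha hN (starTrunc_one ha hN
    (starTrunc_replicate_two ha hN (starTrunc_three ha hN h) b₁))]
  congr 1
  funext k
  have e : (fun k => (-1) ^ k * (2 * halfSum (fun k => (-1) ^ k * g k / node N a k) k) /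
      node N a k ^ 2 / node N a k ^ (2 * b₁)) = fun k => 2 * (factor N a (-(2 * (b₁ : ℤ) + 2)) k *
        halfSum (fun k => (-1) ^ k * g k / node N a k) k) := by
    funext k
    have hk := (node_pos (N := N) ha k).ne'
    rw [factor_bar_even, pow_add]
    field_simp
  have hk := (node_pos (N := N) ha k).ne'
  rw [e, halfSum_const_mul, factor_odd, pow_succ]
  field_simp
  ring

lemma starTrunc_twosIndex (ha : 1 ≤ a) (hN : 1 ≤ N) {d : ℕ} (hd : 1 ≤ d) (b : ℕ → ℕ) (n : ℕ) :
    starTrunc N a (twosIndex (2 * d) oneThree b) n =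
      kernelSum N a (fun k => 2 ^ (2 * d) * (factor N a (2 * (b 0 : ℤ) + 1) k *
        interpTail N a (evalTail d b) k)) n := by
  induction d, hd using Nat.le_induction generalizing b n with
  | base =>
    have h (n : ℕ) : starTrunc N a (twosIndex (2 * 0) oneThree (fun i => b (i + 2))) n =
        kernelSum N a (fun k => (-1) ^ k * weight N a k / node N a k / node N a k ^ (2 * b 2)) n := by
      rw [← starTrunc_replicate_two ha hN (t := []) fun n => by rw [kernelSum_one ha hN]; rfl]
      simp [twosIndex]
    rw [twosIndex_oneThree_succ 0, starTrunc_block ha hN h, evalTail_one]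
    congr 1
    funext k
    have e : (fun k => (-1) ^ k * ((-1) ^ k * weight N a k / node N a k / node N a k ^ (2 * b 2)) /
        node N a k) = fun k => factor N a (2 * (b 2 : ℤ) + 2) k * weight N a k := by
      funext k
      have hk := (node_pos (N := N) ha k).ne'
      have hs : ((-1 : ℝ) ^ k) ^ 2 = 1 := by rw [← pow_mul, mul_comm, pow_mul]; simp
      rw [factor_even, pow_add]
      field_simp
      rw [hs, one_mul]
    rw [e, interpTail, interpTail, interpTail]
    norm_num
  | succ d hd ih =>
    rw [twosIndex_oneThree_succ d, starTrunc_block ha hN (ih fun i => b (i + 2)), evalTail_succ hd]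
    congr 1
    funext k
    have e : (fun k => (-1) ^ k * (2 ^ (2 * d) * (factor N a (2 * (b (0 + 2) : ℤ) + 1) k *
        interpTail N a (evalTail d fun i => b (i + 2)) k)) / node N a k) = fun k => 2 ^ (2 * d) *
          (factor N a (-(2 * (b 2 : ℤ) + 2)) k *
            interpTail N a (evalTail d fun i => b (i + 2)) k) := by
      funext k
      have hk := (node_pos (N := N) ha k).ne'
      rw [factor_odd, factor_bar_even, zero_add, pow_succ, pow_succ, pow_succ]
      field_simp
    have e' : halfSum (fun k => 2 ^ (2 * d) * (factor N a (-(2 * (b 2 : ℤ) + 2)) k *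
            interpTail N a (evalTail d fun i => b (i + 2)) k)) = fun k => 2 ^ (2 * d) *
        interpTail N a (-(2 * (b 2 : ℤ) + 2) :: evalTail d fun i => b (i + 2)) k := by
      funext k
      rw [halfSum_const_mul, interpTail]
    rw [e, e', interpTail]
    simp_rw [mul_left_comm _ ((2 : ℝ) ^ (2 * d))]
    rw [halfSum_const_mul, mul_add, pow_add, interpTail, interpTail]
    ring

/-! ### Truncations as sums over chains -/

lemma starTerm_cons (s : ℕ) (t : List ℕ) (m : ℕ) (k : Fin t.length → ℕ) :
    starTerm N a (s :: t) (Fin.cons m k : Fin (t.length + 1) → ℕ) =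
      1 / node N a m ^ s * starTerm N a t k := by
  unfold starTerm
  exact Fin.prod_univ_succ _

lemma sum_chains_starTerm (s : List ℕ) (n : ℕ) :
    ∑ k ∈ chains (· + 1) s.length (n + 1), starTerm N a s k = starTrunc N a s n := by
  induction s generalizing n with
  | nil => simp [chains, starTerm, starTrunc]
  | cons s t ih =>
    rw [starTrunc]
    refine (sum_chains_succ _ t.length _ _).trans (sum_congr rfl fun m _ => ?_)
    rw [← ih, mul_sum]
    exact sum_congr rfl fun k _ => starTerm_cons s t m k

lemma altTerm_singleton (s : ℤ) (m : ℕ) (k : Fin 0 → ℕ) :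
    altTerm N a [s] (Fin.cons m k : Fin 1 → ℕ) = factor N a s m * weight N a m := by
  simp [altTerm, factor, weight, lastEntry, node]

lemma altTerm_cons_cons (s l : ℤ) (t : List ℤ) (m : ℕ) (k : Fin (t.length + 1) → ℕ) :
    altTerm N a (s :: l :: t) (Fin.cons m k : Fin (t.length + 1 + 1) → ℕ) =
      factor N a s m * altTerm N a (l :: t) k := by
  unfold altTerm
  rw [← mul_assoc]
  congr 1
  exact Fin.prod_univ_succ _

lemma slice_eq_sum_chains (s : ℤ) (t : List ℤ) (m : ℕ) :
    slice N a (s :: t) m = ∑ k ∈ chains id t.length m,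
      altTerm N a (s :: t) (Fin.cons m k : Fin (t.length + 1) → ℕ) := by
  induction t generalizing s m with
  | nil =>
    refine Eq.trans ?_ (Fintype.sum_unique
      fun k : Fin 0 → ℕ => altTerm N a [s] (Fin.cons m k : Fin 1 → ℕ)).symm
    rw [slice, altTerm_singleton]
  | cons l t ih =>
    rw [slice, mul_sum]
    symm
    refine (sum_chains_succ id t.length m _).trans (sum_congr rfl fun j _ => ?_)
    rw [ih, mul_sum]
    exact sum_congr rfl fun k _ => altTerm_cons_cons s l t m _

/-! ### Convergence -/

lemma summable_prod_apply {f : ℕ → ℝ} (hf : Summable f) (h0 : ∀ k, 0 ≤ f k) (u : ℕ) :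
    Summable fun k : Fin u → ℕ => ∏ i, f (k i) := by
  induction u with
  | zero => exact (hasSum_fintype _).summable
  | succ u ih =>
    rw [← (Fin.consEquiv fun _ : Fin (u + 1) => ℕ).summable_iff]
    refine (hf.mul_of_nonneg ih h0 fun k => prod_nonneg fun i _ => h0 _).congr fun p => ?_
    simp [Fin.prod_univ_succ, Fin.consEquiv]

lemma abs_factor_le (ha : 1 ≤ a) (hN : 1 ≤ N) {s : ℤ} {c : ℕ} (hs : c ≤ s.natAbs) (k : ℕ) :
    |factor N a s k| ≤ 1 / ((k : ℝ) + 1) ^ c := by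
  have hx : (k : ℝ) + 1 ≤ node N a k := by
    have h₁ : (1 : ℝ) ≤ N := by exact_mod_cast hN
    have h₂ : (1 : ℝ) ≤ a := by exact_mod_cast ha
    have h₃ : (0 : ℝ) ≤ k := Nat.cast_nonneg k
    unfold node
    nlinarith
  have h1 : |((s.sign : ℤ) : ℝ) ^ k| ≤ 1 := by
    rw [abs_pow]
    refine pow_le_one₀ (abs_nonneg _) ?_
    rcases lt_trichotomy s 0 with h | h | h
    · simp [Int.sign_eq_neg_one_of_neg h]
    · simp [h]
    · simp [Int.sign_eq_one_of_pos h]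
  have h2 : ((k : ℝ) + 1) ^ c ≤ node N a k ^ s.natAbs :=
    (pow_le_pow_right₀ (by linarith [Nat.cast_nonneg (α := ℝ) k]) hs).trans
      (pow_le_pow_left₀ (by positivity) hx _)
  rw [factor, abs_div, abs_of_pos (pow_pos (node_pos ha k) _)]
  exact div_le_div₀ zero_le_one h1 (by positivity) h2

/-- The Pochhammer factor is at most `k_u + 1 ≤ k₁ + 1`, which costs one power of the first
denominator. -/
lemma abs_altTerm_le (ha : 1 ≤ a) (haN : a ≤ N) {s : ℤ} {t : List ℤ} (hs : 3 ≤ s.natAbs)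
    (ht : ∀ x ∈ t, 2 ≤ x.natAbs) {k : Fin (t.length + 1) → ℕ} (hk : Antitone k) :
    |altTerm N a (s :: t) k| ≤ ∏ i, 1 / ((k i : ℝ) + 1) ^ 2 := by
  have hN : 1 ≤ N := ha.trans haN
  have hw : |weight N a (lastEntry k)| ≤ (k 0 : ℝ) + 1 := by
    rw [abs_of_nonneg (weight_nonneg _)]
    refine (weight_le hN haN _).trans ?_
    have : lastEntry k ≤ k 0 := by
      simp only [lastEntry, Nat.succ_pos, dif_pos]
      exact hk (Fin.zero_le _)
    have : (lastEntry k : ℝ) ≤ k 0 := by exact_mod_cast this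
    linarith
  have e : altTerm N a (s :: t) k = (factor N a s (k 0) *
      ∏ i : Fin t.length, factor N a (t.get i) (k i.succ)) * weight N a (lastEntry k) := by
    unfold altTerm
    congr 1
    exact Fin.prod_univ_succ _
  rw [e, abs_mul, abs_mul, abs_prod, Fin.prod_univ_succ]
  have h₁ := abs_factor_le ha hN hs (k 0)
  have h₂ : ∏ i : Fin t.length, |factor N a (t.get i) (k i.succ)| ≤
      ∏ i : Fin t.length, 1 / ((k i.succ : ℝ) + 1) ^ 2 :=
    prod_le_prod (fun i _ => abs_nonneg _) fun i _ => abs_factor_le ha hN (ht _ (List.get_mem t i)) _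
  calc _ ≤ (1 / ((k 0 : ℝ) + 1) ^ 3 * ∏ i : Fin t.length, 1 / ((k i.succ : ℝ) + 1) ^ 2) *
        ((k 0 : ℝ) + 1) := by gcongr
    _ = _ := by field_simp

lemma summable_altTerm (ha : 1 ≤ a) (haN : a ≤ N) {s : ℤ} {t : List ℤ} (hs : 3 ≤ s.natAbs)
    (ht : ∀ x ∈ t, 2 ≤ x.natAbs) :
    Summable fun k : {k : Fin (s :: t).length → ℕ // StrictAnti k} => altTerm N a (s :: t) k.1 := by
  have h : Summable fun k : ℕ => 1 / ((k : ℝ) + 1) ^ 2 := by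
    have := (summable_nat_add_iff 1).2 (Real.summable_one_div_nat_pow.2 (le_refl 2))
    simpa using this
  have h' := (summable_prod_apply h (fun k => by positivity) (s :: t).length).comp_injective
    (i := fun k : {k : Fin (s :: t).length → ℕ // StrictAnti k} => k.1) Subtype.val_injective
  refine Summable.of_norm_bounded h' fun k => ?_
  exact abs_altTerm_le ha haN hs ht k.2.antitone

/-- Summation of an absolutely convergent sum over strictly decreasing indices by the value of the
first index. -/
lemma hasSum_sum_chains {u : ℕ} {F : (Fin (u + 1) → ℕ) → ℝ}
    (h : Summable fun k : {k : Fin (u + 1) → ℕ // StrictAnti k} => F k.1) :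
    HasSum (fun m => ∑ k ∈ chains id u m, F (Fin.cons m k : Fin (u + 1) → ℕ))
      (∑' k : {k : Fin (u + 1) → ℕ // StrictAnti k}, F k.1) := by
  classical
  have hC (n : ℕ) (k : Fin (u + 1) → ℕ) :
      k ∈ chains id (u + 1) n ↔ StrictAnti k ∧ ∀ i, k i < n := mem_chains_id_iff
  have hsum (G : (Fin (u + 1) → ℕ) → ℝ) (n : ℕ) :
      ∑ k ∈ (chains id (u + 1) n).subtype StrictAnti, G k.1 =
        ∑ m ∈ range n, ∑ k ∈ chains id u m, G (Fin.cons m k : Fin (u + 1) → ℕ) :=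
    (sum_subtype_of_bounded hC G n).trans (sum_chains_succ id u n G)
  have habs : Summable fun m => |∑ k ∈ chains id u m, F (Fin.cons m k : Fin (u + 1) → ℕ)| := by
    refine summable_of_sum_range_le
      (c := ∑' k : {k : Fin (u + 1) → ℕ // StrictAnti k}, |F k.1|)
      (fun m => abs_nonneg _) fun n => ?_
    calc _ ≤ ∑ m ∈ range n, ∑ k ∈ chains id u m, |F (Fin.cons m k : Fin (u + 1) → ℕ)| :=
        sum_le_sum fun m _ => abs_sum_le_sum_abs _ _
      _ ≤ _ := by
        rw [← hsum fun k => |F k|]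
        exact h.abs.sum_le_tsum _ fun _ _ => abs_nonneg _
  have hlim : Tendsto (fun n => ∑ k ∈ (chains id (u + 1) n).subtype StrictAnti, F k.1) atTop
      (𝓝 (∑' k : {k : Fin (u + 1) → ℕ // StrictAnti k}, F k.1)) :=
    h.hasSum.comp (tendsto_subtype_atTop hC)
  simp only [hsum] at hlim
  have hS := habs.of_abs.hasSum
  rwa [tendsto_nhds_unique hS.tendsto_sum_nat hlim] at hS

lemma hasSum_slice (s : ℤ) (t : List ℤ)
    (h : Summable fun k : {k : Fin (s :: t).length → ℕ // StrictAnti k} =>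
      altTerm N a (s :: t) k.1) :
    HasSum (slice N a (s :: t)) (tTilde N a (s :: t)) :=
  (hasSum_sum_chains (u := t.length) (F := altTerm N a (s :: t)) h).congr_fun fun m =>
    slice_eq_sum_chains s t m

lemma hasSum_list_map {ι : Type*} (L : List ι) {f : ι → ℕ → ℝ} {c : ι → ℝ}
    (h : ∀ p ∈ L, HasSum (f p) (c p)) :
    HasSum (fun k => (L.map fun p => f p k).sum) (L.map c).sum := by
  induction L with
  | nil => simp [hasSum_zero]
  | cons p L ih =>
    simp only [List.map_cons, List.sum_cons]
    exact (h p List.mem_cons_self).add (ih fun q hq => h q (List.mem_cons_of_mem _ hq))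

/-- Dominated convergence, as the kernel is bounded and tends to `2N / B(a/N, a/N)` pointwise. -/
lemma tendsto_kernelSum (ha : 1 ≤ a) (hN : 1 ≤ N) {g : ℕ → ℝ} {S : ℝ} (hg : HasSum g S) :
    Tendsto (kernelSum N a g) atTop
      (𝓝 (2 * N / ProbabilityTheory.beta ((a : ℝ) / N) ((a : ℝ) / N) * S)) := by
  obtain ⟨C, hC⟩ := (tendsto_kernel_zero_right (N := N) ha hN).bddAbove_range
  rw [← (hg.mul_left _).tsum_eq]
  have h : kernelSum N a g = fun n => ∑' k, kernel N a n k * g k := by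
    funext n
    rw [tsum_eq_sum fun k hk => ?_, kernelSum]
    rw [kernel_eq_zero (by simpa using hk), zero_mul]
  rw [h]
  refine tendsto_tsum_of_dominated_convergence (bound := fun k => C * |g k|)
    (hg.summable.abs.mul_left C) (fun k => (tendsto_kernel ha hN k).mul_const _)
    (Eventually.of_forall fun n k => ?_)
  rw [Real.norm_eq_abs, abs_mul]
  exact mul_le_mul_of_nonneg_right ((abs_kernel_le ha hN n k).trans (hC ⟨n, rfl⟩)) (abs_nonneg _)

/-- The terms are nonnegative, so convergence of the truncations gives summability. -/
lemma hasSum_starTerm {s : List ℕ} {L : ℝ} (h : Tendsto (starTrunc N a s) atTop (𝓝 L)) :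
    HasSum (fun k : {k : Fin s.length → ℕ // Antitone k} => starTerm N a s k.1) L := by
  classical
  have hC (n : ℕ) (k : Fin s.length → ℕ) :
      k ∈ chains (· + 1) s.length n ↔ Antitone k ∧ ∀ i, k i < n := mem_chains_succ_iff
  have h0 (k : {k : Fin s.length → ℕ // Antitone k}) : 0 ≤ starTerm N a s k.1 :=
    prod_nonneg fun i _ => by positivity
  have hsum (n : ℕ) : ∑ k ∈ (chains (· + 1) s.length (n + 1)).subtype Antitone,
      starTerm N a s k.1 = starTrunc N a s n :=
    (sum_subtype_of_bounded hC (starTerm N a s) (n + 1)).trans (sum_chains_starTerm s n)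
  have hatTop := (tendsto_subtype_atTop hC).comp (tendsto_add_atTop_nat 1)
  obtain ⟨C, hCb⟩ := h.bddAbove_range
  have hS : Summable fun k : {k : Fin s.length → ℕ // Antitone k} => starTerm N a s k.1 := by
    refine summable_of_sum_le (c := C) h0 fun F => ?_
    obtain ⟨n, hn⟩ := (hatTop.eventually_ge_atTop F).exists
    calc _ ≤ _ := sum_le_sum_of_subset_of_nonneg hn fun k _ _ => h0 k
      _ ≤ C := by
        simp only [Function.comp_apply]
        rw [hsum]
        exact hCb ⟨n, rfl⟩
  have := tendsto_nhds_unique ((hS.hasSum.comp hatTop).congr hsum) h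
  exact this ▸ hS.hasSum

end

end LevelN

end

theorem mainTheorem12 (N a : ℕ) (ha : 1 ≤ a) (haN : a ≤ N) (d : ℕ) (hd : 1 ≤ d)
    (b : ℕ → ℕ) (hb : 1 ≤ b 0) :
    Summable (fun k : {k : Fin (LevelN.twosIndex (2 * d) LevelN.oneThree b).length → ℕ //
        Antitone k} => LevelN.starTerm N a (LevelN.twosIndex (2 * d) LevelN.oneThree b) k.1) ∧
    (∀ p ∈ LevelN.choices (LevelN.evalIndex d b),
      Summable (fun k : {k : Fin p.2.length → ℕ // StrictAnti k} =>
        LevelN.altTerm N a p.2 k.1)) ∧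
    LevelN.tStar N a (LevelN.twosIndex (2 * d) LevelN.oneThree b) =
      2 ^ (2 * d + 1) * (N : ℝ) /
          ProbabilityTheory.beta ((a : ℝ) / (N : ℝ)) ((a : ℝ) / (N : ℝ)) *
        LevelN.tTildeInterp N a (1 / 2) (LevelN.evalIndex d b) := by
  have hN : 1 ≤ N := ha.trans haN
  have hE : LevelN.evalIndex d b = (2 * (b 0 : ℤ) + 1) :: LevelN.evalTail d b := rfl
  have halt : ∀ p ∈ LevelN.choices (LevelN.evalIndex d b),
      Summable (fun k : {k : Fin p.2.length → ℕ // StrictAnti k} => LevelN.altTerm N a p.2 k.1) ∧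
        HasSum (LevelN.slice N a p.2) (LevelN.tTilde N a p.2) := by
    rintro ⟨r, q⟩ hp
    obtain ⟨h, t, e, hh, ht⟩ := LevelN.exists_cons_of_mem_choices (c := 3) (by omega)
      (fun x => LevelN.two_le_natAbs_of_mem_evalTail) (by omega) (hE ▸ hp)
    simp only at e
    subst e
    have := LevelN.summable_altTerm ha haN hh ht
    exact ⟨this, LevelN.hasSum_slice h t this⟩
  have hInterp : HasSum (fun k => LevelN.factor N a (2 * (b 0 : ℤ) + 1) k *
      LevelN.interpTail N a (LevelN.evalTail d b) k)
      (LevelN.tTildeInterp N a (1 / 2) (LevelN.evalIndex d b)) := by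
    refine (LevelN.hasSum_list_map _ fun p hp =>
      ((halt p hp).2.mul_left ((1 / 2 : ℝ) ^ p.1))).congr_fun fun k => ?_
    rw [hE, LevelN.sum_choices_slice (fun x hx => ?_) (by omega)]
    have := LevelN.two_le_natAbs_of_mem_evalTail hx
    omega
  have hlim := LevelN.tendsto_kernelSum ha hN (hInterp.mul_left (2 ^ (2 * d)))
  have hstar := LevelN.hasSum_starTerm (hlim.congr fun n =>
    (LevelN.starTrunc_twosIndex ha hN hd b n).symm)
  refine ⟨hstar.summable, fun p hp => (halt p hp).1, ?_⟩
  rw [LevelN.tStar, hstar.tsum_eq]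
  ring
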